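/- Let $I=[0,1]$ and let $\mathbb E^2$ be the Euclidean plane. Let $c$ be a real number and let $\rho: I^2\to[1,1+c]$ be a (Lebesgue) measurable function such that there is no biLipschitz map $f: I^2\to\mathbb E^2$ with $$\mathrm{Jac}(f):=\det(Df)=\rho\quad\text{almost everywhere on } I^2 .$$ Then there is a separated net $X\subset\mathbb E^2$ which is not biLipschitz equivalent to $\mathbb Z^2$, that is, there is no biLipschitz bijection $X\to\mathbb Z^2$. Here a subset $X$ of a metric space $Z$ is a separated net if there are constants $a,b>0$ such that $d(x,x')>a$ for all distinct $x,x'\in X$ and $d(z,X)<b$ for every $z\in Z$. A map $f$ between metric spaces is biLipschitz if there is $L\ge 1$ such that $L^{-1}d(x,y)\le d(f(x),f(y))\le L\,d(x,y)$ for all $x,y$. Both $X$ and $\mathbb Z^2$ carry the metric induced from $\mathbb E^2$. -/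

import Mathlib

open MeasureTheory Set

namespace SeparatedNet

/-- The Euclidean plane. -/
abbrev Plane : Type := EuclideanSpace ℝ (Fin 2)

/-- The closed unit square, as a subset of the plane. -/
def unitSquare : Set Plane := {x | ∀ i, x i ∈ Icc (0 : ℝ) 1}

/-- The integer lattice, as a subset of the plane (with the induced Euclidean metric). -/
def integerLattice : Set Plane := {x | ∀ i, ∃ n : ℤ, x i = n}

/-- `X` is a separated net: for some `a, b > 0`, distinct points of `X` have distance greater
than `a`, and every point of the space has distance less than `b` from `X`
(in particular `X` is nonempty if the space is). -/
def IsSeparatedNet {Z : Type*} [MetricSpace Z] (X : Set Z) : Prop :=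
  ∃ a b : ℝ, 0 < a ∧ 0 < b ∧
    (∀ x ∈ X, ∀ x' ∈ X, x ≠ x' → a < dist x x') ∧
    (∀ z : Z, ∃ x ∈ X, dist z x < b)

/-- A map is biLipschitz if, for some `L`, it expands and contracts distances by at most
a factor `L`. -/
def IsBiLipschitz {A B : Type*} [MetricSpace A] [MetricSpace B] (f : A → B) : Prop :=
  ∃ L : NNReal, LipschitzWith L f ∧ AntilipschitzWith L f

/-- Two metric spaces are biLipschitz equivalent (biLipschitz homeomorphic) if there is a
biLipschitz bijection between them. -/
def BiLipschitzEquivalent (A B : Type*) [MetricSpace A] [MetricSpace B] : Prop :=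
  ∃ g : A → B, Function.Bijective g ∧ IsBiLipschitz g

/-- `Jac f = det (Df) = ρ` almost everywhere on `S`: at almost every point of `S` the map
`f|_S` is differentiable, with derivative of (signed) determinant `ρ x`.
For `S` the unit square the derivative relative to `S` is unique, and it
is the usual derivative at interior points. -/
def HasJacobianAE (f : Plane → Plane) (ρ : Plane → ℝ) (S : Set Plane) : Prop :=
  ∀ᵐ x ∂(volume.restrict S), ∃ A : Plane →L[ℝ] Plane,
    HasFDerivWithinAt f A S x ∧ A.det = ρ x

end SeparatedNet

namespace SeparatedNet

open Filter Topology NNReal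

/-! Spread copies of `ρ` at every dyadic scale over the plane, giving a measure `M` with density
between 1 and `1 + c`, and cut the plane into cells of `M`-mass 1 and bounded diameter. One point
near each cell gives a separated net (`exists_net_cells`).

A biLipschitz bijection from this net to the lattice extends to a coarsely biLipschitz map of the
plane that carries `M` to counting measure on the lattice, which is Lebesgue measure moved a bounded
distance. Rescaling the copy of side `2 ^ n` to the unit square makes all the additive errors tend
to 0, so a limit along an ultrafilter is a genuinely biLipschitz `f` with `volume (f '' K) = ∫ ρ`
over compact `K` in the square (`exists_limit_volume_image`).

The area formula then gives `|det Df| = ρ` almost everywhere. Since `f` is injective on the whole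
plane, a winding number argument (`not_det_pos_and_neg`) prevents the determinant from taking both
signs, so `f` or its reflection has Jacobian `ρ`, contrary to the hypothesis. -/

/-! ### Winding numbers and the sign of the determinant. -/

/-- A continuous logarithm of a constant is constant. -/
theorem eq_of_exp_const {T : Type*} [TopologicalSpace T] [PreconnectedSpace T] {D : T → ℂ}
    (hD : Continuous D) {a : ℂ} (h : ∀ t, Complex.exp (D t) = a) (s t : T) : D s = D t := by
  have := Complex.isCoveringMap_exp.eq_of_comp_eq hD (continuous_const (y := D t))
    (by ext u; simp [h]) t rfl
  exact congrFun this s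

/-- The increment of the argument along a loop close to an orientation preserving ellipse. -/
theorem log_increment {l : ℝ → ℂ} (hl : Continuous l) {α β : ℂ} (hαβ : ‖β‖ < ‖α‖)
    {t : ℝ} (ht : Complex.exp (t * Complex.I) = 1)
    (hper : Complex.exp (l t) = Complex.exp (l 0))
    (h : ∀ θ : ℝ, ‖Complex.exp (l θ) - (α * Complex.exp (θ * Complex.I) +
      β * Complex.exp (-(θ * Complex.I)))‖ < ‖α‖ - ‖β‖) :
    l t - l 0 = t * Complex.I := by
  have hα0 : 0 < ‖α‖ := (norm_nonneg β).trans_lt hαβ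
  have hα : α ≠ 0 := norm_pos_iff.1 hα0
  -- Divided by its dominant term, the loop stays within distance 1 of 1. The principal logarithm is
  -- continuous there, so it contributes nothing to the increment.
  set u : ℝ → ℂ := fun θ => Complex.exp (l θ - θ * Complex.I) / α with hu
  have hu1 : ∀ θ, ‖u θ - 1‖ < 1 := by
    intro θ
    have h1 : ‖Complex.exp (l θ - θ * Complex.I) - α‖ < ‖α‖ := by
      have e1 : Complex.exp (l θ - θ * Complex.I) - α =
          (Complex.exp (l θ) - (α * Complex.exp (θ * Complex.I) +
          β * Complex.exp (-(θ * Complex.I)))) * Complex.exp (-(θ * Complex.I)) +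
          β * Complex.exp (-(θ * Complex.I)) * Complex.exp (-(θ * Complex.I)) := by
        have e2 : Complex.exp (θ * Complex.I) * Complex.exp (-(θ * Complex.I)) = 1 := by
          rw [← Complex.exp_add]; simp
        rw [sub_eq_add_neg (l θ), Complex.exp_add]
        linear_combination α * e2
      have e3 : ‖Complex.exp (-(θ * Complex.I))‖ = 1 := by
        rw [← neg_mul, ← Complex.ofReal_neg]; exact Complex.norm_exp_ofReal_mul_I _
      rw [e1]
      refine (norm_add_le _ _).trans_lt ?_
      simp only [norm_mul, e3, mul_one]
      linarith [h θ]
    have : u θ - 1 = (Complex.exp (l θ - θ * Complex.I) - α) / α := by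
      simp only [hu]; field_simp
    rw [this, norm_div, div_lt_one hα0]; exact h1
  have hslit : ∀ θ, u θ ∈ Complex.slitPlane := fun θ => by
    simpa using Complex.mem_slitPlane_of_norm_lt_one (hu1 θ)
  have hucont : Continuous u := by fun_prop
  have hD : Continuous fun θ : ℝ => l θ - θ * Complex.I - Complex.log (u θ) :=
    (by fun_prop : Continuous fun θ : ℝ => l θ - θ * Complex.I).sub (hucont.clog hslit)
  have := eq_of_exp_const hD (a := α) (fun θ => by
    rw [Complex.exp_sub, Complex.exp_log (Complex.slitPlane_ne_zero (hslit θ))]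
    simp only [hu]
    field_simp) t 0
  have hut : u t = u 0 := by simp [hu, Complex.exp_sub, ht, hper]
  simp only [hut, Complex.ofReal_zero, zero_mul, sub_zero, sub_left_inj] at this
  rw [← this]; ring

/-- The identification of the plane with `ℂ`. -/
noncomputable def toComplex : Plane ≃ₗᵢ[ℝ] ℂ := Complex.orthonormalBasisOneI.repr.symm

theorem toComplex_apply (p : Plane) : toComplex p = p 0 + p 1 * Complex.I := by
  simp [toComplex, ← OrthonormalBasis.sum_repr_symm, Fin.sum_univ_two]

/-- The unit vector with argument `θ`. -/
noncomputable def circleVec (θ : ℝ) : Plane := !₂[Real.cos θ, Real.sin θ]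

theorem norm_circleVec (θ : ℝ) : ‖circleVec θ‖ = 1 := by
  simp [circleVec, EuclideanSpace.norm_eq, Fin.sum_univ_two]

theorem continuous_circleVec : Continuous circleVec := by
  unfold circleVec
  refine (PiLp.continuous_toLp 2 _).comp (continuous_pi fun i => ?_)
  fin_cases i <;> simp <;> fun_prop

theorem circleVec_periodic (θ : ℝ) : circleVec (θ + 2 * Real.pi) = circleVec θ := by
  simp [circleVec]

/-- A linear map in complex coordinates. -/
theorem exists_toComplex_circleVec (A : Plane →L[ℝ] Plane) : ∃ α β : ℂ,
    (∀ θ : ℝ, toComplex (A (circleVec θ)) =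
      α * Complex.exp (θ * Complex.I) + β * Complex.exp (-(θ * Complex.I))) ∧
    ‖α‖ ^ 2 - ‖β‖ ^ 2 = A.det := by
  set a := A (EuclideanSpace.single 0 1) with ha
  set b := A (EuclideanSpace.single 1 1) with hb
  -- The complex linear and antilinear parts of `A`, that is, `A z = α z + β z̄`.
  refine ⟨⟨(a 0 + b 1) / 2, (a 1 - b 0) / 2⟩, ⟨(a 0 - b 1) / 2, (a 1 + b 0) / 2⟩, ?_, ?_⟩
  · intro θ
    have h1 : circleVec θ = Real.cos θ • EuclideanSpace.single 0 1 +
        Real.sin θ • EuclideanSpace.single 1 1 := by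
      ext i; fin_cases i <;> simp [circleVec]
    rw [h1, map_add, map_smul, map_smul, ← ha, ← hb, toComplex_apply, ← neg_mul,
      ← Complex.ofReal_neg, Complex.exp_mul_I, Complex.exp_mul_I]
    apply Complex.ext <;> simp [← Complex.ofReal_cos, ← Complex.ofReal_sin,
      -Complex.ofReal_neg] <;> ring
  · have h2 : A.det = a 0 * b 1 - b 0 * a 1 := by
      rw [ContinuousLinearMap.det, ← LinearMap.det_toMatrix (EuclideanSpace.basisFun (Fin 2) ℝ).toBasis,
        Matrix.det_fin_two]
      simp [LinearMap.toMatrix_apply, ha, hb]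
    rw [h2, ← Complex.normSq_eq_norm_sq, ← Complex.normSq_eq_norm_sq, Complex.normSq_mk,
      Complex.normSq_mk]
    ring

/-- Small circles are mapped close to ellipses at a point of differentiability. -/
theorem eventually_norm_circle_sub_lt {f : Plane → Plane} {A : Plane →L[ℝ] Plane} {x : Plane}
    (hf : HasFDerivAt f A x) {η : ℝ} (hη : 0 < η) :
    ∀ᶠ r : ℝ in nhdsWithin (0 : ℝ) (Ioi 0), ∀ θ : ℝ,
      ‖toComplex (f (x + r • circleVec θ) - f x) -
        (r : ℂ) * toComplex (A (circleVec θ))‖ < r * η := by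
  have h := (hasFDerivAt_iff_isLittleO_nhds_zero.1 hf).def (half_pos hη)
  obtain ⟨δ, hδ, h⟩ := Metric.eventually_nhds_iff.1 h
  have : Ioo (0 : ℝ) δ ∈ nhdsWithin (0 : ℝ) (Ioi 0) := Ioo_mem_nhdsGT hδ
  filter_upwards [this] with r hr θ
  have hn : ‖r • circleVec θ‖ = r := by
    rw [norm_smul, norm_circleVec, Real.norm_of_nonneg hr.1.le, mul_one]
  have := h (y := r • circleVec θ) (by rw [dist_zero_right, hn]; exact hr.2)
  rw [hn, map_smul, ← toComplex.norm_map, map_sub, map_smul] at this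
  simp only [Complex.real_smul] at this
  refine this.trans_lt ?_
  nlinarith [hr.1]

/-- An injective continuous map of the plane cannot both preserve and reverse orientation. -/
theorem not_det_pos_and_neg {f : Plane → Plane} (hf : Continuous f) (hinj : Function.Injective f)
    {A B : Plane →L[ℝ] Plane} {x y : Plane} (hA : HasFDerivAt f A x) (hB : HasFDerivAt f B y)
    (hA0 : 0 < A.det) (hB0 : B.det < 0) : False := by
  obtain ⟨α, β, hαβ, hdA⟩ := exists_toComplex_circleVec A
  obtain ⟨γ, δ, hγδ, hdB⟩ := exists_toComplex_circleVec B
  have h1 : ‖β‖ < ‖α‖ := lt_of_pow_lt_pow_left₀ 2 (norm_nonneg _) (by linarith)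
  have h2 : ‖γ‖ < ‖δ‖ := lt_of_pow_lt_pow_left₀ 2 (norm_nonneg _) (by linarith)
  obtain ⟨r, ⟨hrA, hrB⟩, hr : 0 < r⟩ := ((eventually_norm_circle_sub_lt hA (sub_pos.2 h1)).and
    (eventually_norm_circle_sub_lt hB (sub_pos.2 h2)) |>.and self_mem_nhdsWithin).exists
  -- A circle of fixed radius slides from `x` to `y`. Injectivity keeps `H` away from 0, so the
  -- winding number does not change; yet it is 1 at `x` and -1 at `y`.
  set H : ℝ × ℝ → ℂ := fun p => toComplex (f (x + p.1 • (y - x) + r • circleVec p.2) -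
    f (x + p.1 • (y - x))) with hH
  have hHc : Continuous H := by
    have := continuous_circleVec
    refine toComplex.continuous.comp ?_
    fun_prop
  have hH0 : ∀ p, H p ∈ ({0}ᶜ : Set ℂ) := by
    intro p hp
    have : r • circleVec p.2 = 0 := by
      simpa [hH, sub_eq_zero, hinj.eq_iff] using hp
    have h3 := norm_circleVec p.2
    rcases smul_eq_zero.1 this with h | h
    · exact hr.ne' h
    · simp [h] at h3
  have hHper : ∀ s θ, H (s, θ + 2 * Real.pi) = H (s, θ) := by
    intro s θ; simp [hH, circleVec_periodic]
  obtain ⟨Λ, ⟨-, hΛ⟩, -⟩ := Complex.isCoveringMapOn_exp.existsUnique_continuousMap_lifts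
    (⟨H, hHc⟩ : C(ℝ × ℝ, ℂ)) (a₀ := 0) (e₀ := Complex.log (H 0))
    (Complex.exp_log (hH0 0)) hH0
  have hΛ' : ∀ p, Complex.exp (Λ p) = H p := fun p => congrFun hΛ p
  have hk : ∀ p q : ℝ × ℝ, Λ (p.1, p.2 + 2 * Real.pi) - Λ p = Λ (q.1, q.2 + 2 * Real.pi) - Λ q := by
    have hc : Continuous fun p : ℝ × ℝ => Λ (p.1, p.2 + 2 * Real.pi) - Λ p := by fun_prop
    intro p q
    exact eq_of_exp_const hc (a := 1) (fun p => by
      rw [Complex.exp_sub, hΛ', hΛ', hHper p.1 p.2]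
      exact div_self (hH0 p)) p q
  have hrn : ‖(r : ℂ)‖ = r := by simp [abs_of_pos hr]
  have i1 := log_increment (l := fun θ => Λ (0, θ)) (by fun_prop) (α := r * α) (β := r * β)
    (by rw [norm_mul, norm_mul, hrn]; gcongr) (t := 2 * Real.pi)
    (by push_cast; exact Complex.exp_two_pi_mul_I)
    (by simp only [hΛ']; simpa using hHper 0 0)
    (fun θ => by
      have := hrA θ
      rw [hαβ] at this
      simp only [hΛ', hH, norm_mul, hrn, zero_smul, add_zero]
      rw [← mul_sub]
      refine lt_of_eq_of_lt ?_ this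
      congr 1
      ring)
  -- Running the circle backwards swaps the two coefficients, so that the dominant one, `δ`, takes
  -- the place of `α`.
  have i2 := log_increment (l := fun θ => Λ (1, -θ)) (by fun_prop) (α := r * δ) (β := r * γ)
    (by rw [norm_mul, norm_mul, hrn]; gcongr) (t := 2 * Real.pi)
    (by push_cast; exact Complex.exp_two_pi_mul_I)
    (by simp only [hΛ']; simpa using (hHper 1 (-(2 * Real.pi))).symm)
    (fun θ => by
      have := hrB (-θ)
      rw [hγδ] at this
      simp only [hΛ', hH, norm_mul, hrn, one_smul, add_sub_cancel]
      rw [← mul_sub]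
      refine lt_of_eq_of_lt ?_ this
      congr 1
      push_cast
      rw [neg_mul, neg_neg]
      ring)
  have i3 := hk (0, 0) (1, -(2 * Real.pi))
  simp only [zero_add, neg_add_cancel] at i3
  have i4 : Λ (1, -(2 * Real.pi)) - Λ (1, 0) = (2 * Real.pi : ℝ) * Complex.I := by
    simpa using i2
  have i5 : ((2 * Real.pi : ℝ) : ℂ) * Complex.I = 0 := by
    have i6 : Λ (0, 2 * Real.pi) - Λ (0, 0) = (2 * Real.pi : ℝ) * Complex.I := i1
    linear_combination (-1/2 : ℂ) * (i6 + i4 - i3)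
  simp [Real.pi_ne_zero] at i5

/-! ### Limits of coarsely biLipschitz maps. -/

/-- Along an ultrafilter, uniformly coarsely biLipschitz maps converge locally uniformly to a
biLipschitz map. -/
theorem exists_coarse_limit {L : ℝ≥0} {h : ℕ → Plane → Plane} {δ : ℕ → ℝ}
    (hδ : Tendsto δ atTop (𝓝 0))
    (h0 : ∀ n, h n 0 = 0)
    (hlip : ∀ n x y, dist (h n x) (h n y) ≤ L * dist x y + δ n)
    (hanti : ∀ n x y, dist x y ≤ L * dist (h n x) (h n y) + δ n) :
    ∃ f : Plane → Plane, LipschitzWith L f ∧ AntilipschitzWith L f ∧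
      ∀ K : Set Plane, IsCompact K → ∀ ε > 0, ∃ n, δ n < ε ∧ ∀ x ∈ K, dist (h n x) (f x) < ε := by
  -- The `h n` need not be continuous. The ultrafilter gives pointwise limits everywhere at once,
  -- and the coarse Lipschitz bound makes the convergence uniform on compact sets.
  set U : Ultrafilter ℕ := hyperfilter ℕ
  have hδU : Tendsto δ U (𝓝 0) := hδ.mono_left Nat.hyperfilter_le_atTop
  have hlim : ∀ x, ∃ y, Tendsto (fun n => h n x) U (𝓝 y) := by
    intro x
    have hb : ∀ᶠ n in (U : Filter ℕ), h n x ∈ Metric.closedBall (0 : Plane) (L * dist x 0 + 1) := by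
      filter_upwards [hδU.eventually (gt_mem_nhds one_pos)] with n hn
      have := hlip n x 0
      rw [h0] at this
      rw [Metric.mem_closedBall]
      linarith
    obtain ⟨y, -, hy⟩ := (isCompact_closedBall (0 : Plane) (L * dist x 0 + 1)).ultrafilter_le_nhds
      (U.map fun n => h n x) (by rw [le_principal_iff]; exact hb)
    exact ⟨y, hy⟩
  choose f hf using hlim
  have hfl : LipschitzWith L f := LipschitzWith.of_dist_le_mul fun x y => by
    have h1 := ((hf x).dist (hf y))
    have h2 : Tendsto (fun n => L * dist x y + δ n) U (𝓝 (L * dist x y + 0)) :=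
      tendsto_const_nhds.add hδU
    rw [add_zero] at h2
    exact le_of_tendsto_of_tendsto h1 h2 (Eventually.of_forall fun n => hlip n x y)
  have hfa : AntilipschitzWith L f := AntilipschitzWith.of_le_mul_dist fun x y => by
    have h2 : Tendsto (fun n => L * dist (h n x) (h n y) + δ n) U
        (𝓝 (L * dist (f x) (f y) + 0)) :=
      (((hf x).dist (hf y)).const_mul _).add hδU
    rw [add_zero] at h2
    exact ge_of_tendsto h2 (Eventually.of_forall fun n => hanti n x y)
  refine ⟨f, hfl, hfa, fun K hK ε hε => ?_⟩
  set η := ε / (4 * (L + 1)) with hη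
  have hL : (0 : ℝ) < L + 1 := by positivity
  have hη0 : 0 < η := by positivity
  have hLη : L * η ≤ ε / 4 := by
    have : (L + 1) * η = ε / 4 := by rw [hη]; field_simp
    linarith
  obtain ⟨t, -, ht, hKt⟩ := hK.finite_cover_balls hη0
  have hu : ∀ᶠ n in (U : Filter ℕ), ∀ y ∈ t, dist (h n y) (f y) < ε / 4 :=
    (eventually_all_finite ht).2 fun y _ => (hf y).eventually (Metric.ball_mem_nhds _ (by positivity))
  obtain ⟨n, hn, hnδ⟩ := (hu.and (hδU.eventually (gt_mem_nhds (by positivity : 0 < ε / 4)))).exists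
  refine ⟨n, by linarith, fun x hx => ?_⟩
  obtain ⟨y, hy, hxy⟩ := mem_iUnion₂.1 (hKt hx)
  rw [Metric.mem_ball] at hxy
  have h1 := hlip n x y
  have h2 := hn y hy
  have h3 := hfl.dist_le_mul y x
  rw [dist_comm y x] at h3
  have h4 : L * dist x y ≤ L * η := by gcongr
  linarith [dist_triangle4 (h n x) (h n y) (f y) (f x)]

/-- Locally uniform limits of coarsely biLipschitz maps carry limits of measures
to Lebesgue measure. -/
theorem exists_limit_volume_image {L C : ℝ≥0} {h q : ℕ → Plane → Plane} {δ : ℕ → ℝ}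
    {M : ℕ → Measure Plane} {ν : Measure Plane} {S : Set Plane}
    (hδ : Tendsto δ atTop (𝓝 0))
    (h0 : ∀ n, h n 0 = 0)
    (hlip : ∀ n x y, dist (h n x) (h n y) ≤ L * dist x y + δ n)
    (hanti : ∀ n x y, dist x y ≤ L * dist (h n x) (h n y) + δ n)
    (hM : ∀ n A, M n (h n ⁻¹' A) = volume (q n ⁻¹' A))
    (hq : ∀ n w, dist (q n w) w ≤ δ n)
    (hC : ∀ n, M n ≤ C • (volume : Measure Plane))
    (hν : ∀ n K, IsCompact K → K ⊆ S → M n K = ν K) :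
    ∃ f : Plane → Plane, LipschitzWith L f ∧ AntilipschitzWith L f ∧
      ∀ K, IsCompact K → K ⊆ S → volume (f '' K) = ν K := by
  obtain ⟨f, hfl, hfa, hf⟩ := exists_coarse_limit hδ h0 hlip hanti
  refine ⟨f, hfl, hfa, fun K hK hKS => le_antisymm ?_ ?_⟩
  -- The `h n`-preimage of a neighbourhood of `f '' K` lies in a thin neighbourhood of `K`. Its part
  -- outside `K` may leave `S`, so only the bound by `C` controls it; its volume tends to 0.
  · have key : ∀ ε > 0, volume (f '' K) ≤
        ν K + C * volume.restrict Kᶜ (Metric.cthickening (2 * L * ε + ε) K) := by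
      intro ε hε
      obtain ⟨n, hnδ, hn⟩ := hf K hK ε hε
      set T := Metric.cthickening (2 * L * ε + ε) K
      have h1 : h n ⁻¹' {p | ∃ x ∈ K, dist p (f x) ≤ ε} ⊆ T := by
        rintro z ⟨x, hx, hzx⟩
        refine Metric.mem_cthickening_of_dist_le z x _ _ hx ?_
        have h2 := hanti n z x
        have h3 : L * dist (h n z) (h n x) ≤ L * (2 * ε) := by
          gcongr
          linarith [dist_triangle_right (h n z) (h n x) (f x), hn x hx]
        linarith
      calc volume (f '' K) ≤ volume (q n ⁻¹' {p | ∃ x ∈ K, dist p (f x) ≤ ε}) := by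
            apply measure_mono
            rintro _ ⟨x, hx, rfl⟩
            exact ⟨x, hx, (hq n _).trans hnδ.le⟩
        _ = M n (h n ⁻¹' {p | ∃ x ∈ K, dist p (f x) ≤ ε}) := (hM n _).symm
        _ ≤ M n (K ∪ T ∩ Kᶜ) := by
            apply measure_mono
            intro z hz
            by_cases hzK : z ∈ K
            · exact Or.inl hzK
            · exact Or.inr ⟨h1 hz, hzK⟩
        _ ≤ M n K + M n (T ∩ Kᶜ) := measure_union_le _ _
        _ ≤ ν K + C * volume.restrict Kᶜ T := by
            rw [hν n K hK hKS, Measure.restrict_apply Metric.isClosed_cthickening.measurableSet]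
            gcongr
            exact hC n _
    have hlim : Tendsto (fun ε : ℝ => ν K + C * volume.restrict Kᶜ
        (Metric.cthickening (2 * L * ε + ε) K)) (𝓝[>] 0) (𝓝 (ν K)) := by
      have h1 := tendsto_measure_cthickening_of_isCompact (μ := volume.restrict Kᶜ) hK
      have h2 : Tendsto (fun ε : ℝ => 2 * L * ε + ε) (𝓝[>] 0) (𝓝 0) := by
        have : Continuous fun ε : ℝ => 2 * L * ε + ε := by fun_prop
        simpa using (this.tendsto 0).mono_left nhdsWithin_le_nhds
      have h3 := ENNReal.Tendsto.const_mul (a := (C : ENNReal)) (h1.comp h2)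
        (Or.inr ENNReal.coe_ne_top)
      have h4 : volume.restrict Kᶜ K = 0 := by
        rw [Measure.restrict_apply hK.measurableSet]; simp
      rw [h4, mul_zero] at h3
      simpa using h3.const_add (ν K)
    exact ge_of_tendsto hlim (eventually_nhdsWithin_of_forall fun ε hε => key ε hε)
  -- Conversely, `q n` moves points so little that the volume involved lies in a thickening of the
  -- compact set `f '' K`.
  · have key : ∀ ε > 0, ν K ≤ volume (Metric.cthickening (2 * ε) (f '' K)) := by
      intro ε hε
      obtain ⟨n, hnδ, hn⟩ := hf K hK ε hε
      calc ν K = M n K := (hν n K hK hKS).symm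
        _ ≤ M n (h n ⁻¹' {p | ∃ x ∈ K, dist p (f x) ≤ ε}) :=
            measure_mono fun x hx => ⟨x, hx, (hn x hx).le⟩
        _ = volume (q n ⁻¹' {p | ∃ x ∈ K, dist p (f x) ≤ ε}) := hM n _
        _ ≤ _ := by
            apply measure_mono
            rintro w ⟨x, hx, hwx⟩
            refine Metric.mem_cthickening_of_dist_le w (f x) _ _ (mem_image_of_mem f hx) ?_
            linarith [dist_triangle_left w (f x) (q n w), hq n w]
    have hlim : Tendsto (fun ε : ℝ => volume (Metric.cthickening (2 * ε) (f '' K)))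
        (𝓝[>] 0) (𝓝 (volume (f '' K))) := by
      have h1 := tendsto_measure_cthickening_of_isCompact (μ := (volume : Measure Plane))
        (hK.image hfl.continuous)
      have h2 : Tendsto (fun ε : ℝ => 2 * ε) (𝓝[>] 0) (𝓝 0) := by
        have : Continuous fun ε : ℝ => 2 * ε := by fun_prop
        simpa using (this.tendsto 0).mono_left nhdsWithin_le_nhds
      exact h1.comp h2
    exact ge_of_tendsto hlim (eventually_nhdsWithin_of_forall fun ε hε => key ε hε)

/-! ### From volumes of images to the Jacobian. -/

theorem isCompact_unitSquare : IsCompact unitSquare := by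
  have : unitSquare = (EuclideanSpace.equiv (Fin 2) ℝ).toHomeomorph ⁻¹'
      (univ.pi fun _ => Icc (0 : ℝ) 1) := by
    ext x; simp only [mem_preimage, mem_univ_pi]; rfl
  rw [this, Homeomorph.isCompact_preimage]
  exact isCompact_univ_pi fun _ => isCompact_Icc

/-- The absolute value of the Jacobian of a biLipschitz map is the density of its pull-back of
Lebesgue measure. -/
theorem ae_abs_det_fderiv_eq {L : ℝ≥0} {f : Plane → Plane} (hfl : LipschitzWith L f)
    (hfa : AntilipschitzWith L f) {S : Set Plane} (hS : MeasurableSet S) {r : Plane → ENNReal}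
    (hr : Measurable r) (hfin : ∫⁻ x in S, r x ≠ ⊤)
    (hvol : ∀ K, IsCompact K → K ⊆ S → volume (f '' K) = ∫⁻ x in K, r x) :
    ∀ᵐ x ∂volume.restrict S, ENNReal.ofReal |(fderiv ℝ f x).det| = r x := by
  have hinj := hfa.injective
  set D : Set Plane := {x | DifferentiableAt ℝ f x}
  have hD : MeasurableSet D := measurableSet_of_differentiableAt ℝ f
  have hDae : ∀ᵐ x, x ∈ D := hfl.ae_differentiableAt
  have : IsFiniteMeasure ((volume.restrict S).withDensity r) :=
    isFiniteMeasure_withDensity hfin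
  have hν : ∀ s, MeasurableSet s → s ⊆ S →
      (volume.restrict S).withDensity r s = ∫⁻ x in s, r x := fun s hs hsS => by
    rw [withDensity_apply _ hs, Measure.restrict_restrict hs, inter_eq_left.2 hsS]
  -- By the area formula the left side is `volume (f '' s)`. Inner regularity, in the image and in
  -- the domain, reduces each inequality to compact sets; `f` is a closed embedding, so compact sets
  -- pull back to compact sets.
  have key : ∀ s, MeasurableSet s → s ⊆ S → s ⊆ D →
      ∫⁻ x in s, ENNReal.ofReal |(fderiv ℝ f x).det| = ∫⁻ x in s, r x := by
    intro s hs hsS hsD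
    have hd : ∀ x ∈ s, HasFDerivWithinAt f (fderiv ℝ f x) s x := fun x hx =>
      (hsD hx).hasFDerivAt.hasFDerivWithinAt
    have hms : MeasurableSet (f '' s) := measurable_image_of_fderivWithin hs hd hinj.injOn
    rw [lintegral_abs_det_fderiv_eq_addHaar_image _ hs hd hinj.injOn]
    apply le_antisymm
    · rw [hms.measure_eq_iSup_isCompact]
      refine iSup₂_le fun K' hK's => iSup_le fun hK' => ?_
      have hK : IsCompact (f ⁻¹' K') :=
        (hfa.isClosedEmbedding hfl.uniformContinuous).isCompact_preimage hK'
      have hKs : f ⁻¹' K' ⊆ s := fun x hx => by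
        obtain ⟨y, hy, hyx⟩ := hK's hx
        rwa [← hinj hyx]
      have hK'f : f '' (f ⁻¹' K') = K' := image_preimage_eq_of_subset
        (hK's.trans (image_subset_range f s))
      calc volume K' = ∫⁻ x in f ⁻¹' K', r x := by
            rw [← hvol _ hK (hKs.trans hsS), hK'f]
        _ ≤ ∫⁻ x in s, r x := lintegral_mono_set hKs
    · rw [← hν s hs hsS, hs.measure_eq_iSup_isCompact]
      refine iSup₂_le fun K hKs => iSup_le fun hK => ?_
      rw [hν K hK.measurableSet (hKs.trans hsS), ← hvol K hK (hKs.trans hsS)]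
      exact measure_mono (image_mono hKs)
  have hdet : Measurable fun x => ENNReal.ofReal |(fderiv ℝ f x).det| :=
    ((ContinuousLinearMap.continuous_det.abs).measurable.comp
      (measurable_fderiv ℝ f)).ennreal_ofReal
  refine ae_eq_of_forall_setLIntegral_eq_of_sigmaFinite hdet hr fun s hs _ => ?_
  have hsD : (s ∩ S ∩ D : Set Plane) =ᵐ[volume] (s ∩ S : Set Plane) :=
    inter_ae_eq_left_of_ae_eq_univ (eventuallyEq_univ.2 hDae)
  rw [Measure.restrict_restrict hs, ← Measure.restrict_congr_set hsD]
  exact key _ ((hs.inter hS).inter hD) (inter_subset_left.trans inter_subset_right)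
    inter_subset_right

/-- A reflection of the plane. -/
noncomputable def planeConj : Plane ≃ₗᵢ[ℝ] Plane :=
  (toComplex.trans Complex.conjLIE).trans toComplex.symm

theorem det_planeConj : (planeConj : Plane →L[ℝ] Plane).det = -1 := by
  have : ((planeConj : Plane →L[ℝ] Plane) : Plane →ₗ[ℝ] Plane) =
      (toComplex.symm.toLinearEquiv : ℂ →ₗ[ℝ] Plane) ∘ₗ
        (Complex.conjLIE.toLinearEquiv : ℂ →ₗ[ℝ] ℂ) ∘ₗ
        (toComplex.symm.toLinearEquiv.symm : Plane →ₗ[ℝ] ℂ) := by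
    ext x : 1; rfl
  rw [ContinuousLinearMap.det, this, LinearMap.det_conj, Complex.det_conjLIE]

/-- A map whose absolute Jacobian is prescribed has, up to a reflection, the prescribed
Jacobian. -/
theorem exists_hasJacobianAE {L : ℝ≥0} {f : Plane → Plane} (hfl : LipschitzWith L f)
    (hfa : AntilipschitzWith L f) {S : Set Plane} {ρ : Plane → ℝ}
    (hρ : ∀ᵐ x ∂volume.restrict S, 0 < ρ x)
    (hf : ∀ᵐ x ∂volume.restrict S, ENNReal.ofReal |(fderiv ℝ f x).det| = ENNReal.ofReal (ρ x)) :
    ∃ g : Plane → Plane, LipschitzWith L g ∧ AntilipschitzWith L g ∧ HasJacobianAE g ρ S := by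
  have hdiff : ∀ᵐ x ∂volume.restrict S, DifferentiableAt ℝ f x :=
    ae_restrict_of_ae hfl.ae_differentiableAt
  have hae : ∀ᵐ x ∂volume.restrict S, DifferentiableAt ℝ f x ∧ |(fderiv ℝ f x).det| = ρ x := by
    filter_upwards [hρ, hf, hdiff] with x hx hfx hd
    exact ⟨hd, (ENNReal.ofReal_eq_ofReal_iff (abs_nonneg _) hx.le).1 hfx⟩
  by_cases h : ∃ y, DifferentiableAt ℝ f y ∧ (fderiv ℝ f y).det < 0
  · obtain ⟨y, hy, hy0⟩ := h
    refine ⟨planeConj ∘ f, by simpa using planeConj.lipschitz.comp hfl,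
      by simpa using planeConj.antilipschitz.comp hfa, ?_⟩
    filter_upwards [hae] with x hx
    refine ⟨(planeConj : Plane →L[ℝ] Plane).comp (fderiv ℝ f x),
      ((planeConj : Plane →L[ℝ] Plane).hasFDerivAt.comp x hx.1.hasFDerivAt).hasFDerivWithinAt, ?_⟩
    have hle : (fderiv ℝ f x).det ≤ 0 := by
      by_contra hlt
      exact not_det_pos_and_neg hfl.continuous hfa.injective hx.1.hasFDerivAt hy.hasFDerivAt
        (not_le.1 hlt) hy0
    rw [← hx.2, abs_of_nonpos hle, ContinuousLinearMap.det, ContinuousLinearMap.toLinearMap_comp,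
      LinearMap.det_comp]
    have := det_planeConj
    rw [ContinuousLinearMap.det] at this
    rw [this, neg_one_mul]
  · push Not at h
    refine ⟨f, hfl, hfa, ?_⟩
    filter_upwards [hae] with x hx
    exact ⟨fderiv ℝ f x, hx.1.hasFDerivAt.hasFDerivWithinAt, by
      rw [← hx.2, abs_of_nonneg (h x hx.1)]⟩

/-! ### Cells of unit mass and the separated net. -/

/-- A half-open box of height one. -/
def box (x y : ℝ) (b : ℤ) : Set Plane := {p | p 0 ∈ Ico x y ∧ p 1 ∈ Ico (b : ℝ) (b + 1)}

theorem box_eq_preimage (x y : ℝ) (b : ℤ) : box x y b =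
    (MeasurableEquiv.toLp 2 (Fin 2 → ℝ)).symm ⁻¹' univ.pi
      fun i => Ico ((![x, (b : ℝ)] : Fin 2 → ℝ) i) ((![y, (b : ℝ) + 1] : Fin 2 → ℝ) i) := by
  ext p
  simp only [mem_preimage, mem_univ_pi, Fin.forall_fin_two]
  rfl

theorem measurableSet_box (x y : ℝ) (b : ℤ) : MeasurableSet (box x y b) := by
  rw [box_eq_preimage]
  exact (MeasurableEquiv.measurable _) (MeasurableSet.univ_pi fun _ => measurableSet_Ico)

theorem volume_box (x y : ℝ) (b : ℤ) : volume (box x y b) = ENNReal.ofReal (y - x) := by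
  rw [box_eq_preimage, (EuclideanSpace.volume_preserving_symm_measurableEquiv_toLp
    (Fin 2)).measure_preimage_equiv, Real.volume_pi_Ico]
  simp [Fin.prod_univ_two]

theorem box_eq_empty {x y : ℝ} (h : y ≤ x) (b : ℤ) : box x y b = ∅ := by
  ext p; simp [box, Ico_eq_empty_of_le h]

/-- A measure comparable with Lebesgue measure has a biLipschitz distribution function on each
horizontal strip of height one. -/
theorem exists_strip_distribution {C : ℝ≥0} {M : Measure Plane} (hM1 : volume ≤ M)
    (hMC : M ≤ C • (volume : Measure Plane)) (b : ℤ) :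
    ∃ F : ℝ → ℝ, Function.Surjective F ∧ (∀ x y, x ≤ y → y - x ≤ F y - F x) ∧
      (∀ x y, x ≤ y → F y - F x ≤ C * (y - x)) ∧
      ∀ x y, x ≤ y → M (box x y b) = ENNReal.ofReal (F y - F x) := by
  have hle : ∀ x y, M (box x y b) ≤ ENNReal.ofReal (C * (y - x)) := fun x y => by
    refine (hMC _).trans_eq ?_
    rw [Measure.smul_apply, volume_box, ENNReal.ofReal_mul C.coe_nonneg, ENNReal.smul_def, smul_eq_mul]
    simp
  have hfin : ∀ x y, M (box x y b) ≠ ⊤ := fun x y => ne_top_of_le_ne_top ENNReal.ofReal_ne_top (hle x y)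
  set m : ℝ → ℝ → ℝ := fun x y => (M (box x y b)).toReal with hm
  have hadd : ∀ x y z, x ≤ y → y ≤ z → m x z = m x y + m y z := by
    intro x y z hxy hyz
    have h1 : box x z b = box x y b ∪ box y z b := by
      ext p
      simp only [box, mem_ofPred_eq, mem_union, ← Ico_union_Ico_eq_Ico hxy hyz]
      tauto
    have h2 : Disjoint (box x y b) (box y z b) := by
      rw [Set.disjoint_left]
      rintro p ⟨h3, -⟩ ⟨h4, -⟩
      exact absurd h3.2 (not_lt.2 h4.1)
    simp only [hm]
    rw [h1, measure_union h2 (measurableSet_box _ _ _), ENNReal.toReal_add (hfin _ _) (hfin _ _)]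
  have hzero : ∀ x y, y ≤ x → m x y = 0 := fun x y h => by simp [hm, box_eq_empty h]
  have hlow : ∀ x y, y - x ≤ m x y := fun x y => by
    have := ENNReal.toReal_mono (hfin x y) (hM1 (box x y b))
    rw [volume_box] at this
    exact ((le_max_left _ _).trans_eq ENNReal.toReal_ofReal'.symm).trans this
  have hup : ∀ x y, x ≤ y → m x y ≤ C * (y - x) := fun x y h =>
    ENNReal.toReal_le_of_le_ofReal (mul_nonneg C.coe_nonneg (sub_nonneg.2 h)) (hle x y)
  -- Reversed boxes are empty, so one of the two terms always vanishes: this is the signed mass from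
  -- 0 to `x`.
  set F : ℝ → ℝ := fun x => m 0 x - m x 0 with hF
  have hFm : ∀ x y, x ≤ y → F y - F x = m x y := by
    intro x y hxy
    simp only [hF]
    rcases le_total 0 x with hx | hx
    · rw [hzero x 0 hx, hzero y 0 (hx.trans hxy), hadd 0 x y hx hxy]; ring
    · rcases le_total 0 y with hy | hy
      · rw [hzero y 0 hy, hzero 0 x hx, hadd x 0 y hx hy]; ring
      · rw [hzero 0 x hx, hzero 0 y hy, hadd x y 0 hxy hy]; ring
  have hF1 : ∀ x y, x ≤ y → y - x ≤ F y - F x := fun x y h => by rw [hFm x y h]; exact hlow x y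
  have hFC : ∀ x y, x ≤ y → F y - F x ≤ C * (y - x) := fun x y h => by
    rw [hFm x y h]; exact hup x y h
  have hF0 : F 0 = 0 := by simp [hF]
  have hcont : Continuous F := by
    refine (LipschitzWith.of_dist_le_mul (K := C) fun x y => ?_).continuous
    rw [Real.dist_eq, Real.dist_eq]
    rcases le_total x y with h | h
    · rw [abs_sub_comm, abs_of_nonneg (by linarith [hF1 x y h]), abs_sub_comm,
        abs_of_nonneg (by linarith)]
      exact hFC x y h
    · rw [abs_of_nonneg (by linarith [hF1 y x h]), abs_of_nonneg (by linarith)]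
      exact hFC y x h
  refine ⟨F, hcont.surjective ?_ ?_, hF1, hFC, fun x y h => ?_⟩
  · refine tendsto_atTop_mono' _ ?_ tendsto_id
    filter_upwards [eventually_ge_atTop 0] with x hx
    have := hF1 0 x hx
    simp only [hF0, id] at *
    linarith
  · refine tendsto_atBot_mono' _ ?_ tendsto_id
    filter_upwards [eventually_le_atBot 0] with x hx
    have := hF1 x 0 hx
    simp only [hF0, id] at *
    linarith
  · rw [hFm x y h, ENNReal.ofReal_toReal (hfin _ _)]

theorem abs_apply_sub_le_dist (x y : Plane) (i : Fin 2) : |x i - y i| ≤ dist x y := by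
  rw [dist_eq_norm, ← Real.norm_eq_abs]
  exact PiLp.norm_apply_le (x - y) i

theorem dist_le_two {x y : Plane} (h : ∀ i, |x i - y i| ≤ 1) : dist x y ≤ 2 := by
  rw [EuclideanSpace.dist_eq]
  refine Real.sqrt_le_iff.2 ⟨by norm_num, ?_⟩
  have h0 := sq_le_one_iff_abs_le_one _ |>.2 (h 0)
  have h1 := sq_le_one_iff_abs_le_one _ |>.2 (h 1)
  simp only [Fin.sum_univ_two, Real.dist_eq, sq_abs]
  linarith

/-- A measure comparable with Lebesgue measure is the transport, by a map at bounded distance from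
the identity, of the counting measure of a separated net. -/
theorem exists_net_cells {C : ℝ≥0} {M : Measure Plane} (hM1 : volume ≤ M)
    (hMC : M ≤ C • (volume : Measure Plane)) :
    ∃ (ι : ℤ × ℤ → Plane) (S : Plane → ℤ × ℤ), Function.Injective ι ∧
      IsSeparatedNet (range ι) ∧ (∀ z, dist (ι (S z)) z ≤ 2) ∧
      ∀ a, MeasurableSet (S ⁻¹' {a}) ∧ M (S ⁻¹' {a}) = 1 := by
  choose F hFs hF1 hFC hFM using exists_strip_distribution hM1 hMC
  have hlt : ∀ b x y, F b x < F b y ↔ x < y := fun b x y => by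
    constructor
    · intro h
      by_contra h'
      linarith [hF1 b y x (not_lt.1 h')]
    · intro h
      linarith [hF1 b x y h.le]
  have hle : ∀ b x y, F b x ≤ F b y ↔ x ≤ y := fun b x y => by
    rw [← not_lt, ← not_lt, hlt]
  choose G hG using hFs
  -- `ι a` is the lower left corner of the cell with index `a`. Rows have height 1, and since `F`
  -- does not contract, cells of mass 1 have width at most 1.
  set ι : ℤ × ℤ → Plane := fun a => !₂[G a.2 a.1, (a.2 : ℝ)] with hι
  set S : Plane → ℤ × ℤ := fun z => (⌊F ⌊z 1⌋ (z 0)⌋, ⌊z 1⌋) with hS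
  have hdist : ∀ z, dist (ι (S z)) z ≤ 2 := by
    intro z
    refine dist_le_two (Fin.forall_fin_two.2 ⟨?_, ?_⟩)
    · simp only [hι, hS, PiLp.toLp_apply, Matrix.cons_val_zero]
      set b := ⌊z 1⌋
      set x := G b ⌊F b (z 0)⌋
      have hx : F b x = ⌊F b (z 0)⌋ := hG _ _
      have h1 := Int.floor_le (F b (z 0))
      have h2 := Int.lt_floor_add_one (F b (z 0))
      rw [← hx] at h1 h2
      have h3 := (hle _ _ _).1 h1
      rw [abs_sub_comm, abs_of_nonneg (sub_nonneg.2 h3)]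
      linarith [hF1 b _ _ h3]
    · simp only [hι, hS, PiLp.toLp_apply, Matrix.cons_val_one, Matrix.cons_val_fin_one]
      rw [abs_sub_comm, abs_of_nonneg (sub_nonneg.2 (Int.floor_le _))]
      linarith [Int.lt_floor_add_one (z 1)]
  -- Within a row this is the `C`-Lipschitz bound on `F`; between rows the heights differ by at
  -- least 1. The constant `C + 1` serves both cases.
  have hsep : ∀ a a', a ≠ a' → 1 ≤ (C + 1) * dist (ι a) (ι a') := by
    intro a a' haa
    by_cases hb : a.2 = a'.2
    · have hd : |G a.2 a.1 - G a'.2 a'.1| ≤ dist (ι a) (ι a') :=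
        abs_apply_sub_le_dist (ι a) (ι a') 0
      rw [hb] at hd
      have hm : a.1 ≠ a'.1 := fun h => haa (Prod.ext h hb)
      have key : ∀ i j : ℤ, i < j → 1 ≤ (C + 1) * |G a'.2 i - G a'.2 j| := by
        intro i j hij
        have h1 : G a'.2 i ≤ G a'.2 j := by
          rw [← hle a'.2, hG, hG]; exact_mod_cast hij.le
        have h2 := hFC a'.2 _ _ h1
        rw [hG, hG] at h2
        have h3 : (i : ℝ) + 1 ≤ j := by exact_mod_cast hij
        rw [abs_sub_comm, abs_of_nonneg (sub_nonneg.2 h1)]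
        linarith
      have hC : (0 : ℝ) ≤ C + 1 := by positivity
      refine le_trans ?_ (mul_le_mul_of_nonneg_left hd hC)
      rcases lt_or_gt_of_ne hm with h | h
      · exact key _ _ h
      · rw [abs_sub_comm]; exact key _ _ h
    · have hd : |(a.2 : ℝ) - a'.2| ≤ dist (ι a) (ι a') := abs_apply_sub_le_dist (ι a) (ι a') 1
      have h1 : (1 : ℝ) ≤ |(a.2 : ℝ) - a'.2| := by
        exact_mod_cast Int.one_le_abs (sub_ne_zero.2 hb)
      nlinarith [C.coe_nonneg]
  -- `C + 2` in place of `C + 1` makes the separation strict.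
  refine ⟨ι, S, fun a a' h => ?_, ⟨1 / (C + 2), 3, by positivity, by norm_num, ?_, fun z => ?_⟩,
    hdist, fun a => ?_⟩
  · by_contra hne
    have := hsep a a' hne
    rw [h, dist_self] at this
    norm_num at this
  · rintro _ ⟨a, rfl⟩ _ ⟨a', rfl⟩ hne
    have := hsep a a' (fun h => hne (by rw [h]))
    have hC : (0 : ℝ) < C + 2 := by positivity
    have hd : 0 < dist (ι a) (ι a') := dist_pos.2 hne
    rw [div_lt_iff₀ hC]
    nlinarith
  · exact ⟨ι (S z), ⟨_, rfl⟩, by rw [dist_comm]; linarith [hdist z]⟩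
  · have : S ⁻¹' {a} = box (G a.2 a.1) (G a.2 ((a.1 : ℝ) + 1)) a.2 := by
      ext z
      simp only [hS, mem_preimage, mem_singleton_iff, Prod.ext_iff, box, mem_ofPred_eq, mem_Ico]
      rw [← Int.floor_eq_iff (a := z 1), ← hle a.2, ← hlt a.2 (z 0), hG, hG, ← Int.floor_eq_iff]
      constructor
      · rintro ⟨h1, h2⟩
        rw [h2] at h1
        exact ⟨h1, h2⟩
      · rintro ⟨h1, h2⟩
        rw [h2]
        exact ⟨h1, rfl⟩
    rw [this]
    refine ⟨measurableSet_box _ _ _, ?_⟩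
    rw [hFM _ _ _ ((hle a.2 _ _).1 (by rw [hG, hG]; linarith)), hG, hG]
    simp

/-! ### The lattice, and the coarse map induced by a bijection. -/

/-- The lattice points, indexed by pairs of integers. -/
noncomputable def latticePoint (a : ℤ × ℤ) : Plane := !₂[(a.1 : ℝ), (a.2 : ℝ)]

theorem injective_latticePoint : Function.Injective latticePoint := fun a a' h => by
  have h0 := congrArg (fun p : Plane => p 0) h
  have h1 := congrArg (fun p : Plane => p 1) h
  simp only [latticePoint, PiLp.toLp_apply, Matrix.cons_val_zero, Matrix.cons_val_one,
    Matrix.cons_val_fin_one, Int.cast_inj] at h0 h1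
  exact Prod.ext h0 h1

theorem range_latticePoint : range latticePoint = integerLattice := by
  ext p
  simp only [mem_range, integerLattice, mem_ofPred_eq, Fin.forall_fin_two]
  constructor
  · rintro ⟨a, rfl⟩
    exact ⟨⟨a.1, by simp [latticePoint]⟩, ⟨a.2, by simp [latticePoint]⟩⟩
  · rintro ⟨⟨m, hm⟩, ⟨n, hn⟩⟩
    refine ⟨(m, n), ?_⟩
    ext i
    fin_cases i <;> simp [latticePoint, hm, hn]

/-- The index of the lattice point below a point of the plane. -/
noncomputable def latticeIndex (z : Plane) : ℤ × ℤ := (⌊z 0⌋, ⌊z 1⌋)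

theorem dist_latticePoint_latticeIndex (z : Plane) :
    dist (latticePoint (latticeIndex z)) z ≤ 2 := by
  refine dist_le_two (Fin.forall_fin_two.2 ⟨?_, ?_⟩) <;>
    simp only [latticePoint, latticeIndex, PiLp.toLp_apply, Matrix.cons_val_zero,
      Matrix.cons_val_one, Matrix.cons_val_fin_one] <;>
    rw [abs_sub_comm, abs_of_nonneg (sub_nonneg.2 (Int.floor_le _))]
  · linarith [Int.lt_floor_add_one (z 0)]
  · linarith [Int.lt_floor_add_one (z 1)]

theorem latticeIndex_preimage (a : ℤ × ℤ) :
    latticeIndex ⁻¹' {a} = box a.1 (a.1 + 1) a.2 := by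
  ext z
  simp only [latticeIndex, mem_preimage, mem_singleton_iff, Prod.ext_iff, box, mem_ofPred_eq,
    mem_Ico, Int.floor_eq_iff]

/-- A transport map onto a counting measure counts points. -/
theorem measure_preimage_comp_eq_encard {M : Measure Plane} {S : Plane → ℤ × ℤ}
    (hS : ∀ a, MeasurableSet (S ⁻¹' {a}) ∧ M (S ⁻¹' {a}) = 1) {ι : ℤ × ℤ → Plane}
    (hι : Function.Injective ι) (A : Set Plane) :
    M ((fun z => ι (S z)) ⁻¹' A) = ((A ∩ range ι).encard : ENNReal) := by
  have h1 : (fun z => ι (S z)) ⁻¹' A = S ⁻¹' (ι ⁻¹' A) := rfl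
  -- The preimage is a countable union of measurable cells, so `A` itself may be arbitrary.
  rw [h1, ← tsum_measure_preimage_singleton (to_countable _) fun a _ => (hS a).1]
  simp only [(hS _).2]
  rw [ENNReal.tsum_one, ← image_preimage_eq_inter_range, hι.encard_image]
  rfl

/-- A biLipschitz bijection from a net onto the integer lattice yields a coarsely biLipschitz
map of the plane. -/
theorem exists_coarse_of_biLipschitzEquivalent {M : Measure Plane} {ι : ℤ × ℤ → Plane}
    {S : Plane → ℤ × ℤ} (hι : Function.Injective ι) (hd : ∀ z, dist (ι (S z)) z ≤ 2)
    (hS : ∀ a, MeasurableSet (S ⁻¹' {a}) ∧ M (S ⁻¹' {a}) = 1)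
    (h : BiLipschitzEquivalent (range ι) integerLattice) :
    ∃ (L : ℝ≥0) (δ : ℝ) (P q : Plane → Plane),
      (∀ x y, dist (P x) (P y) ≤ L * dist x y + δ) ∧
      (∀ x y, dist x y ≤ L * dist (P x) (P y) + δ) ∧
      (∀ w, dist (q w) w ≤ δ) ∧ ∀ A, M (P ⁻¹' A) = volume (q ⁻¹' A) := by
  obtain ⟨g, hg, L, hgl, hga⟩ := h
  obtain ⟨κ, hκ⟩ : ∃ κ : ℤ × ℤ → Plane, ∀ a, κ a = g ⟨ι a, mem_range_self a⟩ := ⟨_, fun _ => rfl⟩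
  have hκi : Function.Injective κ := fun a a' h => by
    rw [hκ, hκ] at h
    exact hι (congrArg Subtype.val (hg.1 (Subtype.ext h)))
  have hκr : range κ = integerLattice := by
    ext p
    constructor
    · rintro ⟨a, rfl⟩
      rw [hκ]
      exact (g _).2
    · intro hp
      obtain ⟨⟨_, a, rfl⟩, ha⟩ := hg.2 ⟨p, hp⟩
      exact ⟨a, (hκ a).trans (congrArg Subtype.val ha)⟩
  have hl : ∀ a a', dist (κ a) (κ a') ≤ L * dist (ι a) (ι a') := fun a a' => by
    rw [hκ, hκ]
    exact hgl.dist_le_mul ⟨ι a, mem_range_self a⟩ ⟨ι a', mem_range_self a'⟩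
  have ha : ∀ a a', dist (ι a) (ι a') ≤ L * dist (κ a) (κ a') := fun a a' => by
    rw [hκ, hκ]
    exact hga.le_mul_dist ⟨ι a, mem_range_self a⟩ ⟨ι a', mem_range_self a'⟩
  have h4 : ∀ x y, dist (ι (S x)) (ι (S y)) ≤ dist x y + 4 := fun x y => by
    have := dist_triangle4 (ι (S x)) x y (ι (S y))
    rw [dist_comm y (ι (S y))] at this
    linarith [hd x, hd y]
  have h4' : ∀ x y, dist x y ≤ dist (ι (S x)) (ι (S y)) + 4 := fun x y => by
    have := dist_triangle4 x (ι (S x)) (ι (S y)) y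
    rw [dist_comm x (ι (S x))] at this
    linarith [hd x, hd y]
  -- Moving both endpoints by at most 2 costs 4 in distance, hence `4 * L` after the Lipschitz
  -- bound. Both final maps push their measures to counting measure on the lattice.
  refine ⟨L, 4 * (L + 1), fun z => κ (S z), fun w => latticePoint (latticeIndex w),
    fun x y => ?_, fun x y => ?_, fun w => ?_, fun A => ?_⟩
  · have := mul_le_mul_of_nonneg_left (h4 x y) L.coe_nonneg
    have h5 := hl (S x) (S y)
    linarith
  · linarith [h4' x y, ha (S x) (S y), L.coe_nonneg]
  · have h5 : (0 : ℝ) ≤ L := L.coe_nonneg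
    linarith [dist_latticePoint_latticeIndex w]
  · rw [measure_preimage_comp_eq_encard hS hκi, hκr, measure_preimage_comp_eq_encard (M := volume)
      (fun a => ?_) injective_latticePoint, range_latticePoint]
    rw [latticeIndex_preimage]
    exact ⟨measurableSet_box _ _ _, by rw [volume_box]; simp⟩

/-! ### Dyadic rescaling and the multiscale density. -/

/-- The dilation by `2⁻ⁿ` that sends `p` to the origin. -/
noncomputable def zoom (n : ℕ) (p : Plane) : Plane ≃ᵐ Plane :=
  ((Homeomorph.subRight p).trans
    (Homeomorph.smulOfNeZero ((2 ^ n : ℝ)⁻¹) (by positivity))).toMeasurableEquiv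

theorem zoom_apply (n : ℕ) (p z : Plane) : zoom n p z = ((2 ^ n : ℝ)⁻¹) • (z - p) := rfl

theorem zoom_symm_apply (n : ℕ) (p x : Plane) : (zoom n p).symm x = (2 ^ n : ℝ) • x + p := by
  rw [MeasurableEquiv.symm_apply_eq, zoom_apply, add_sub_cancel_right, inv_smul_smul₀ (by positivity)]

theorem dist_zoom (n : ℕ) (p x y : Plane) :
    dist (zoom n p x) (zoom n p y) = (2 ^ n : ℝ)⁻¹ * dist x y := by
  rw [zoom_apply, zoom_apply, dist_smul₀, dist_sub_right, Real.norm_of_nonneg (by positivity)]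

theorem dist_zoom_symm (n : ℕ) (p x y : Plane) :
    dist ((zoom n p).symm x) ((zoom n p).symm y) = 2 ^ n * dist x y := by
  rw [zoom_symm_apply, zoom_symm_apply, dist_add_right, dist_smul₀,
    Real.norm_of_nonneg (by positivity)]

theorem map_zoom_volume (n : ℕ) (p : Plane) :
    (volume : Measure Plane).map (zoom n p) = (4 ^ n : ENNReal) • (volume : Measure Plane) := by
  have h1 : (zoom n p : Plane → Plane) = (fun x => ((2 ^ n : ℝ)⁻¹) • x) ∘ fun z => z - p := rfl
  rw [h1, ← Measure.map_map (measurable_const_smul _) (measurable_sub_const p),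
    (measurePreserving_sub_right volume p).map_eq, Measure.map_addHaar_smul _ (by positivity)]
  congr 1
  rw [finrank_euclideanSpace_fin, abs_of_nonneg (by positivity), inv_pow, inv_inv, ← pow_mul,
    mul_comm, pow_mul, ENNReal.ofReal_pow (by norm_num)]
  norm_num

/-- The lower left corner of the square of side `2ⁿ` carrying a copy of the given density. -/
noncomputable def corner (n : ℕ) : Plane := !₂[2 ^ n, 0]

/-- A density on the plane containing copies of a given one at all dyadic scales. -/
noncomputable def multiscale (r : Plane → ENNReal) (z : Plane) : ENNReal :=
  -- The scale is constant on vertical strips. For `z 0 < 1` the default values give scale 0; off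
  -- the copies of the square only the bounds on `r` matter.
  r (zoom (Nat.log 2 ⌊z 0⌋₊) (corner (Nat.log 2 ⌊z 0⌋₊)) z)

theorem measurable_multiscale {r : Plane → ENNReal} (hr : Measurable r) :
    Measurable (multiscale r) := by
  have h1 : Measurable fun p : ℕ × Plane => r (zoom p.1 (corner p.1) p.2) :=
    measurable_from_prod_countable_right fun n => hr.comp (zoom n (corner n)).measurable
  have h2 : Measurable fun z : Plane => Nat.log 2 ⌊z 0⌋₊ := by
    have : Measurable fun z : Plane => z 0 := by fun_prop
    exact (measurable_from_nat (f := Nat.log 2)).comp (Nat.measurable_floor.comp this)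
  have h3 := h1.comp (h2.prodMk measurable_id)
  unfold multiscale
  simpa only [Function.comp_def, id] using h3

/-- The square at scale `n` has first coordinates from `2 ^ n` to `2 ^ (n + 1)`. Its right edge
already belongs to the next scale and must be excluded. -/
theorem multiscale_zoom_symm (r : Plane → ENNReal) (n : ℕ) {x : Plane} (hx : x ∈ unitSquare)
    (hx1 : x 0 ≠ 1) : multiscale r ((zoom n (corner n)).symm x) = r x := by
  have h0 : ((zoom n (corner n)).symm x) 0 = 2 ^ n * (x 0 + 1) := by
    rw [zoom_symm_apply]
    simp [corner]; ring
  have hlog : Nat.log 2 ⌊((zoom n (corner n)).symm x) 0⌋₊ = n := by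
    have hx0 := (hx 0).1
    have hxlt := lt_of_le_of_ne (hx 0).2 hx1
    have h2 : (0 : ℝ) < 2 ^ n := by positivity
    rw [h0]
    apply Nat.log_eq_of_pow_le_of_lt_pow
    · apply Nat.le_floor
      push_cast
      nlinarith
    · rw [Nat.floor_lt (by positivity)]
      push_cast
      rw [pow_succ]
      nlinarith
  rw [multiscale, hlog, MeasurableEquiv.apply_symm_apply]

theorem ae_apply_ne (i : Fin 2) (t : ℝ) : ∀ᵐ x : Plane, x i ≠ t := by
  have h := (EuclideanSpace.volume_preserving_symm_measurableEquiv_toLp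
    (Fin 2)).quasiMeasurePreserving.ae (p := fun f : Fin 2 → ℝ => f i ≠ t) (by
      rw [ae_iff]
      simpa [volume_pi] using Measure.pi_hyperplane (fun _ : Fin 2 => (volume : Measure ℝ)) i t)
  exact h

/-- Change of variables: areas scale by `4 ^ n`, and the excluded edge is null. -/
theorem map_zoom_multiscale_apply {r : Plane → ENNReal} (hr : Measurable r) (n : ℕ) {K : Set Plane}
    (hK : MeasurableSet K) (hKS : K ⊆ unitSquare) :
    (volume.withDensity (multiscale r)).map (zoom n (corner n)) K = 4 ^ n * ∫⁻ x in K, r x := by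
  set e := zoom n (corner n)
  have hm : Measurable fun x => multiscale r (e.symm x) :=
    (measurable_multiscale hr).comp e.symm.measurable
  calc (volume.withDensity (multiscale r)).map e K
      = ∫⁻ z in e ⁻¹' K, multiscale r (e.symm (e z)) := by
        rw [e.map_apply, withDensity_apply _ (e.measurable hK)]
        simp
    _ = ∫⁻ x in K, multiscale r (e.symm x) ∂((volume : Measure Plane).map e) :=
        (setLIntegral_map hK hm e.measurable).symm
    _ = 4 ^ n * ∫⁻ x in K, multiscale r (e.symm x) := by
        rw [map_zoom_volume, Measure.restrict_smul, lintegral_smul_measure, smul_eq_mul]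
    _ = 4 ^ n * ∫⁻ x in K, r x := by
        congr 1
        refine setLIntegral_congr_fun_ae hK ?_
        filter_upwards [ae_apply_ne 0 1] with x hx hxK
        exact multiscale_zoom_symm r n (hKS hxK) hx

/-! ### The dichotomy and the conclusion. -/

/-- Either some separated net is not biLipschitz equivalent to the integer lattice, or a given
density is the pull-back of Lebesgue measure by a biLipschitz map of the plane. -/
theorem exists_net_or_biLipschitz {C : ℝ≥0} {r : Plane → ENNReal} (hr : Measurable r)
    (hr1 : ∀ x, 1 ≤ r x) (hrC : ∀ x, r x ≤ C) :
    (∃ X : Set Plane, IsSeparatedNet X ∧ ¬ BiLipschitzEquivalent X integerLattice) ∨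
    ∃ (L : ℝ≥0) (f : Plane → Plane), LipschitzWith L f ∧ AntilipschitzWith L f ∧
      ∀ K, IsCompact K → K ⊆ unitSquare → volume (f '' K) = ∫⁻ x in K, r x := by
  set M : Measure Plane := volume.withDensity (multiscale r) with hM
  have hM1 : volume ≤ M := by
    have := withDensity_mono (μ := (volume : Measure Plane)) (f := fun _ => 1)
      (g := multiscale r) (Eventually.of_forall fun z => hr1 _)
    rwa [withDensity_const, one_smul] at this
  have hMC : M ≤ C • (volume : Measure Plane) := by
    have := withDensity_mono (μ := (volume : Measure Plane)) (g := fun _ => (C : ENNReal))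
      (f := multiscale r) (Eventually.of_forall fun z => hrC _)
    rwa [withDensity_const] at this
  obtain ⟨ι, S, hι, hnet, hd, hS⟩ := exists_net_cells hM1 hMC
  by_cases hbl : BiLipschitzEquivalent (range ι) integerLattice
  swap
  · exact Or.inl ⟨_, hnet, hbl⟩
  right
  obtain ⟨L, D, P, q, hPl, hPa, hq, hPq⟩ := exists_coarse_of_biLipschitzEquivalent hι hd hS hbl
  set e : ℕ → Plane ≃ᵐ Plane := fun n => zoom n (corner n)
  -- Centring the target zoom at the image of the corner makes each rescaled map fix the origin, as
  -- the limit argument needs.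
  set p : ℕ → Plane := fun n => P ((e n).symm 0)
  have h4 : ∀ n, ((4 ^ n : ENNReal))⁻¹ * 4 ^ n = 1 := fun n =>
    ENNReal.inv_mul_cancel (by simp) (by simp)
  refine ⟨L, (exists_limit_volume_image (L := L) (C := C)
    (h := fun n x => zoom n (p n) (P ((e n).symm x)))
    (q := fun n w => zoom n (p n) (q ((zoom n (p n)).symm w)))
    (δ := fun n => (2 ^ n : ℝ)⁻¹ * D)
    (M := fun n => ((4 ^ n : ENNReal))⁻¹ • M.map (e n))
    (ν := volume.withDensity r) (S := unitSquare) ?_ ?_ ?_ ?_ ?_ ?_ ?_ ?_).imp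
    fun f hf => ⟨hf.1, hf.2.1, fun K hK hKS => by
      rw [hf.2.2 K hK hKS, withDensity_apply _ hK.measurableSet]⟩⟩
  · have : Tendsto (fun n : ℕ => (2 ^ n : ℝ)⁻¹) atTop (𝓝 0) :=
      (tendsto_pow_atTop_atTop_of_one_lt (by norm_num)).inv_tendsto_atTop
    simpa using this.mul_const D
  · intro n
    simp [zoom_apply, p]
  · intro n x y
    rw [dist_zoom]
    have h1 := mul_le_mul_of_nonneg_left (hPl ((e n).symm x) ((e n).symm y))
      (by positivity : (0 : ℝ) ≤ (2 ^ n)⁻¹)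
    rw [dist_zoom_symm] at h1
    refine h1.trans_eq ?_
    field_simp
  · intro n x y
    rw [dist_zoom]
    have h1 := mul_le_mul_of_nonneg_left (hPa ((e n).symm x) ((e n).symm y))
      (by positivity : (0 : ℝ) ≤ (2 ^ n)⁻¹)
    rw [dist_zoom_symm] at h1
    calc dist x y = (2 ^ n)⁻¹ * (2 ^ n * dist x y) := by field_simp
      _ ≤ _ := h1
      _ = _ := by ring
  · intro n A
    have h1 : e n ⁻¹' ((fun x => zoom n (p n) (P ((e n).symm x))) ⁻¹' A) =
        P ⁻¹' (zoom n (p n) ⁻¹' A) := by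
      ext z; simp
    have h2 : zoom n (p n) ⁻¹' ((fun w => zoom n (p n) (q ((zoom n (p n)).symm w))) ⁻¹' A) =
        q ⁻¹' (zoom n (p n) ⁻¹' A) := by
      ext z; simp
    rw [Measure.smul_apply, (e n).map_apply, h1, hPq, ← h2, ← (zoom n (p n)).map_apply,
      map_zoom_volume, Measure.smul_apply, smul_eq_mul, smul_eq_mul, ← mul_assoc, h4, one_mul]
  · intro n w
    nth_rw 2 [← (zoom n (p n)).apply_symm_apply w]
    rw [dist_zoom]
    exact mul_le_mul_of_nonneg_left (hq _) (by positivity)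
  · intro n
    refine Measure.le_iff'.2 fun A => ?_
    have h1 := Measure.map_mono hMC (e n).measurable A
    rw [Measure.map_smul, map_zoom_volume] at h1
    rw [Measure.smul_apply]
    calc ((4 ^ n : ENNReal))⁻¹ • M.map (e n) A
        ≤ ((4 ^ n : ENNReal))⁻¹ * (C • (4 ^ n : ENNReal) • (volume : Measure Plane)) A := by
          rw [smul_eq_mul]; gcongr
      _ = (((4 ^ n : ENNReal))⁻¹ * 4 ^ n) * (C * volume A) := by
          simp only [Measure.smul_apply, ENNReal.smul_def, smul_eq_mul]; ring
      _ = _ := by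
          rw [h4, one_mul, Measure.smul_apply, ENNReal.smul_def, smul_eq_mul]
  · intro n K hK hKS
    rw [Measure.smul_apply, map_zoom_multiscale_apply hr n hK.measurableSet hKS, smul_eq_mul,
      ← mul_assoc, h4, one_mul, withDensity_apply _ hK.measurableSet]

end SeparatedNet

theorem mainTheorem3 (c : ℝ) (ρ : SeparatedNet.Plane → ℝ)
    (hρ_meas : AEMeasurable ρ (volume.restrict SeparatedNet.unitSquare))
    (hρ_range : ∀ x ∈ SeparatedNet.unitSquare, ρ x ∈ Icc 1 (1 + c))
    (hρ : ¬ ∃ f : SeparatedNet.Plane → SeparatedNet.Plane,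
      SeparatedNet.IsBiLipschitz (fun x : SeparatedNet.unitSquare => f x) ∧
      SeparatedNet.HasJacobianAE f ρ SeparatedNet.unitSquare) :
    ∃ X : Set SeparatedNet.Plane, SeparatedNet.IsSeparatedNet X ∧
      ¬ SeparatedNet.BiLipschitzEquivalent X SeparatedNet.integerLattice := by
  have hS := SeparatedNet.isCompact_unitSquare
  have hc : 1 ≤ 1 + c := by
    have := hρ_range 0 (fun i => by simp)
    exact this.1.trans this.2
  -- Clamping a measurable representative makes the bounds hold on the whole plane without changing
  -- `ρ` almost everywhere on the square.
  set r : SeparatedNet.Plane → ENNReal :=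
    fun x => ENNReal.ofReal (max 1 (min (1 + c) (hρ_meas.mk ρ x))) with hr
  have hrm : Measurable r :=
    (measurable_const.max (measurable_const.min hρ_meas.measurable_mk)).ennreal_ofReal
  have hr1 : ∀ x, 1 ≤ r x := fun x => by
    rw [hr, ENNReal.one_le_ofReal]; exact le_max_left _ _
  have hrC : ∀ x, r x ≤ ((1 + c).toNNReal : NNReal) := fun x =>
    ENNReal.ofReal_le_ofReal (max_le hc (min_le_left _ _))
  have hrρ : ∀ᵐ x ∂volume.restrict SeparatedNet.unitSquare,
      r x = ENNReal.ofReal (ρ x) ∧ 0 < ρ x := by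
    filter_upwards [hρ_meas.ae_eq_mk, ae_restrict_mem hS.measurableSet] with x hx hxS
    have := hρ_range x hxS
    rw [hr]
    simp only [← hx, min_eq_right this.2, max_eq_right this.1, true_and]
    linarith [this.1]
  rcases SeparatedNet.exists_net_or_biLipschitz hrm hr1 hrC with h | ⟨L, f, hfl, hfa, hf⟩
  · exact h
  have hfin : ∫⁻ x in SeparatedNet.unitSquare, r x ≠ ⊤ := by
    rw [← hf _ hS subset_rfl]
    exact (hS.image hfl.continuous).measure_ne_top
  have hjac := SeparatedNet.ae_abs_det_fderiv_eq hfl hfa hS.measurableSet hrm hfin hf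
  obtain ⟨g, hgl, hga, hg⟩ := SeparatedNet.exists_hasJacobianAE (ρ := ρ) hfl hfa
    (hrρ.mono fun x hx => hx.2) (by
      filter_upwards [hjac, hrρ] with x hx hx'
      rw [hx, hx'.1])
  refine absurd ⟨g, ⟨L, ?_, ?_⟩, hg⟩ hρ
  · exact fun x y => hgl x y
  · exact fun x y => hga x y
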